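/- Let $\mathcal{A}$ be a complex Banach algebra with identity $1$, and let $\sigma(b)$ denote the spectrum of $b\in\mathcal{A}$. An element $b\in\mathcal{A}$ is called quasinilpotent if $\sigma(b)=\{0\}$. An element $a\in\mathcal{A}$ is called - *generalized Drazin invertible* if there is $x\in\mathcal{A}$ with $ax=xa$, $xax=x$ and $a-a^2x$ quasinilpotent; - *eg-Drazin invertible* if there is $x\in\mathcal{A}$ with $ax=xa$, $xax=x$ and $a-a^2x$ generalized Drazin invertible. Let $\mathcal{A}^{acc}$ be the set of all $b\in\mathcal{A}$ such that $b-\lambda 1$ is generalized Drazin invertible for every $\lambda\in\mathbb{C}\setminus\{0\}$. An *ag-Drazin inverse* of $a$ is an element $x\in\mathcal{A}$ with $ax=xa$, $xax=x$ and $a-a^2x\in\mathcal{A}^{acc}$; the element $a$ is *ag-Drazin invertible* if it has an ag-Drazin inverse. For every $a\in\mathcal{A}$ the following statements are equivalent: 1. $a$ is ag-Drazin invertible and it has some ag-Drazin inverse $x$ for which the spectrum $\sigma(a-a^2x)$ is a finite set; 2. $a$ is eg-Drazin invertible; 3. $a$ is generalized Drazin invertible. -/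

import Mathlib

/-- `a` is quasinilpotent: its spectrum is exactly `{0}`. -/
def IsQuasinilpotentElem {A : Type*} [NormedRing A] [NormedAlgebra ℂ A] (a : A) : Prop :=
  spectrum ℂ a = {0}

/-- `x` is a generalized Drazin inverse of `a`. -/
structure IsGDrazinInverse {A : Type*} [NormedRing A] [NormedAlgebra ℂ A] (a x : A) : Prop where
  comm : a * x = x * a
  outer : x * a * x = x
  qnil : IsQuasinilpotentElem (a - a ^ 2 * x)

/-- `a` is generalized Drazin invertible. -/
def IsGDrazinInvertible {A : Type*} [NormedRing A] [NormedAlgebra ℂ A] (a : A) : Prop :=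
  ∃ x : A, IsGDrazinInverse a x

/-- `x` is an extended generalized Drazin (eg-Drazin) inverse of `a`. -/
structure IsEGDrazinInverse {A : Type*} [NormedRing A] [NormedAlgebra ℂ A] (a x : A) : Prop where
  comm : a * x = x * a
  outer : x * a * x = x
  gDrazin : IsGDrazinInvertible (a - a ^ 2 * x)

/-- `a` is eg-Drazin invertible. -/
def IsEGDrazinInvertible {A : Type*} [NormedRing A] [NormedAlgebra ℂ A] (a : A) : Prop :=
  ∃ x : A, IsEGDrazinInverse a x

/-- The class `A^acc`: `a - λ1` is generalized Drazin invertible for every nonzero `λ`. -/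
def IsAccElem {A : Type*} [NormedRing A] [NormedAlgebra ℂ A] (a : A) : Prop :=
  ∀ z : ℂ, z ≠ 0 → IsGDrazinInvertible (a - algebraMap ℂ A z)

/-- `x` is an ag-Drazin inverse of `a`. -/
structure IsAGDrazinInverse {A : Type*} [NormedRing A] [NormedAlgebra ℂ A] (a x : A) : Prop where
  comm : a * x = x * a
  outer : x * a * x = x
  acc : IsAccElem (a - a ^ 2 * x)

/-!
Two commuting outer inverses add up: if `x` is one of `a` and `y` is one of the residual
`a - a ^ 2 * x`, then `x + y` is one of `a`, with the residual of `y`. It therefore suffices to find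
a generalized Drazin inverse of an element `b` with finite spectrum.

The complement of a finite subset of `ℂ` is connected, so `b` keeps its spectrum in the closed
subalgebra that it generates, and we may argue with the characters `φ` of a commutative Banach
algebra. Lagrange interpolation gives a polynomial `e` in `b` with `φ e = 0` where `φ b = 0` and
`φ e = 1` elsewhere. The equation `y - y ^ 2 = s` with `s` quasinilpotent is solved by the Catalan
series `y = ∑ catalan n • s ^ (n + 1)`, which corrects `e` to an idempotent `f` with the same
characters. Then `b + (1 - f)` is invertible, and `f * (b + (1 - f))⁻¹` is the desired inverse.
-/

open scoped NNReal
open Polynomial WeakDual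
open Finset.HasAntidiagonal (antidiagonal mem_antidiagonal)

/-- `x` commutes with `a` and is an outer inverse of `a`. These are the algebraic conditions shared
by the generalized Drazin, eg-Drazin and ag-Drazin inverses, which differ only in what they require
of the residual `a - a ^ 2 * x`. -/
structure IsCommOuterInverse {R : Type*} [Mul R] (a x : R) : Prop where
  comm : Commute a x
  outer : x * a * x = x

namespace IsCommOuterInverse

section SemigroupWithZero

variable {R : Type*} [SemigroupWithZero R] {a x y : R}

theorem mul_eq_zero (hy : IsCommOuterInverse a y) (hax : a * x = 0) : y * x = 0 := by
  calc y * x = y * (a * y) * x := by rw [← mul_assoc, hy.outer]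
    _ = y * y * (a * x) := by rw [hy.comm.eq]; simp only [mul_assoc]
    _ = 0 := by rw [hax, mul_zero]

theorem mul_eq_zero' (hy : IsCommOuterInverse a y) (hxa : x * a = 0) : x * y = 0 := by
  calc x * y = x * (a * y * y) := by rw [hy.comm.eq, hy.outer]
    _ = x * a * (y * y) := by simp only [mul_assoc]
    _ = 0 := by rw [hxa, zero_mul]

end SemigroupWithZero

variable {R : Type*} [Ring R] {a x y : R}

theorem residual_mul (hx : IsCommOuterInverse a x) : (a - a ^ 2 * x) * x = 0 := by
  have hax : a * x * x = x := by rw [hx.comm.eq, hx.outer]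
  calc (a - a ^ 2 * x) * x = a * x - a * (a * x * x) := by noncomm_ring
    _ = 0 := by rw [hax, sub_self]

theorem mul_residual (hx : IsCommOuterInverse a x) : x * (a - a ^ 2 * x) = 0 := by
  have hcomm : Commute x (a - a ^ 2 * x) :=
    hx.comm.symm.sub_right ((hx.comm.symm.pow_right 2).mul_right (.refl x))
  rw [hcomm.eq, hx.residual_mul]

theorem mul_eq_residual_mul (hx : IsCommOuterInverse a x)
    (hy : IsCommOuterInverse (a - a ^ 2 * x) y) : a * y = (a - a ^ 2 * x) * y := by
  rw [sub_mul, mul_assoc (a ^ 2), hy.mul_eq_zero' hx.mul_residual, mul_zero, sub_zero]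

theorem mul_eq_mul_residual (hx : IsCommOuterInverse a x)
    (hy : IsCommOuterInverse (a - a ^ 2 * x) y) : y * a = y * (a - a ^ 2 * x) := by
  rw [mul_sub, (hx.comm.pow_left 2).eq, ← mul_assoc, hy.mul_eq_zero hx.residual_mul, zero_mul,
    sub_zero]

theorem add (hx : IsCommOuterInverse a x) (hy : IsCommOuterInverse (a - a ^ 2 * x) y) :
    IsCommOuterInverse a (x + y) where
  comm := by
    refine hx.comm.add_right ?_
    rw [Commute, SemiconjBy, hx.mul_eq_residual_mul hy, hx.mul_eq_mul_residual hy, hy.comm.eq]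
  outer := by
    have hyax : y * a * x = 0 := by
      rw [hx.mul_eq_mul_residual hy, mul_assoc, hx.residual_mul, mul_zero]
    have hxay : x * a * y = 0 := by
      rw [mul_assoc, hx.mul_eq_residual_mul hy, ← mul_assoc, hx.mul_residual, zero_mul]
    have hyay : y * a * y = y := by rw [hx.mul_eq_mul_residual hy, hy.outer]
    calc (x + y) * a * (x + y) = x * a * x + x * a * y + y * a * x + y * a * y := by noncomm_ring
      _ = x + y := by rw [hx.outer, hxay, hyax, hyay, add_zero, add_zero]

theorem residual_add (hx : IsCommOuterInverse a x) (hy : IsCommOuterInverse (a - a ^ 2 * x) y) :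
    a - a ^ 2 * (x + y) = (a - a ^ 2 * x) - (a - a ^ 2 * x) ^ 2 * y := by
  have hay := hx.mul_eq_residual_mul hy
  have hya := hx.mul_eq_mul_residual hy
  set b := a - a ^ 2 * x with hb
  have hsq : a ^ 2 * y = b ^ 2 * y := by
    calc a ^ 2 * y = a * (b * y) := by rw [sq, mul_assoc, hay]
      _ = a * y * b := by rw [hy.comm.eq, mul_assoc]
      _ = b ^ 2 * y := by rw [hay, mul_assoc, ← hy.comm.eq, ← mul_assoc, sq]
  rw [mul_add, ← sub_sub, ← hb, hsq]

end IsCommOuterInverse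

section NormedAlgebra

variable {A : Type*} [NormedRing A] [NormedAlgebra ℂ A] {a x : A}

theorem IsQuasinilpotentElem.nontrivial (ha : IsQuasinilpotentElem a) : Nontrivial A := by
  by_contra hA
  rw [not_nontrivial_iff_subsingleton] at hA
  exact Set.singleton_ne_empty (0 : ℂ) (ha.symm.trans (spectrum.of_subsingleton a))

theorem IsQuasinilpotentElem.isUnit_sub_algebraMap (ha : IsQuasinilpotentElem a) {z : ℂ}
    (hz : z ≠ 0) : IsUnit (a - algebraMap ℂ A z) := by
  have hmem : z ∉ spectrum ℂ a := by rw [ha]; exact hz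
  rwa [spectrum.notMem_iff, ← IsUnit.neg_iff, neg_sub] at hmem

theorem isGDrazinInvertible_of_isUnit [Nontrivial A] (ha : IsUnit a) :
    IsGDrazinInvertible a := by
  obtain ⟨u, rfl⟩ := ha
  refine ⟨↑u⁻¹, by simp, by simp, ?_⟩
  rw [sq, Units.mul_inv_cancel_right, sub_self]
  exact spectrum.zero_eq

theorem IsQuasinilpotentElem.isAccElem (ha : IsQuasinilpotentElem a) : IsAccElem a :=
  have := ha.nontrivial
  fun _ hz => isGDrazinInvertible_of_isUnit (ha.isUnit_sub_algebraMap hz)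

theorem IsAccElem.nontrivial (ha : IsAccElem a) : Nontrivial A :=
  let ⟨_, hx⟩ := ha 1 one_ne_zero
  hx.qnil.nontrivial

theorem IsGDrazinInverse.isAGDrazinInverse (hx : IsGDrazinInverse a x) :
    IsAGDrazinInverse a x :=
  ⟨hx.comm, hx.outer, hx.qnil.isAccElem⟩

theorem IsEGDrazinInverse.isGDrazinInvertible (hx : IsEGDrazinInverse a x) :
    IsGDrazinInvertible a := by
  obtain ⟨y, hy⟩ := hx.gDrazin
  have hax : IsCommOuterInverse a x := ⟨hx.comm, hx.outer⟩
  have hby : IsCommOuterInverse (a - a ^ 2 * x) y := ⟨hy.comm, hy.outer⟩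
  have hsum := hax.add hby
  exact ⟨x + y, hsum.comm, hsum.outer, by rw [hax.residual_add hby]; exact hy.qnil⟩

theorem IsGDrazinInvertible.map {B : Type*} [NormedRing B] [NormedAlgebra ℂ B] [CompleteSpace B]
    [Nontrivial B] (ha : IsGDrazinInvertible a) (φ : A →ₐ[ℂ] B) : IsGDrazinInvertible (φ a) := by
  obtain ⟨x, hx⟩ := ha
  refine ⟨φ x, by rw [← map_mul, hx.comm, map_mul], by rw [← map_mul, ← map_mul, hx.outer], ?_⟩
  have hsub := AlgHom.spectrum_apply_subset φ (a - a ^ 2 * x)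
  rw [hx.qnil, map_sub, map_mul, map_pow] at hsub
  exact (spectrum.nonempty _).subset_singleton_iff.1 hsub

theorem summable_norm_pow_mul_pow_of_lt_inv_spectralRadius [CompleteSpace A] {r : ℝ≥0}
    (hr : (r : ENNReal) < (spectralRadius ℂ a)⁻¹) :
    Summable fun n : ℕ => ‖a ^ n‖ * (r : ℝ) ^ n := by
  obtain ⟨R, hrR, hR⟩ := ENNReal.lt_iff_exists_nnreal_btwn.1 hr
  have hR0 : 0 < R := zero_le.trans_lt (ENNReal.coe_lt_coe.1 hrR)
  have hball := (spectrum.hasFPowerSeriesOnBall_inverse_one_sub_smul ℂ a).exchange_radius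
    ((spectrum.differentiableOn_inverse_one_sub_smul hR).hasFPowerSeriesOnBall hR0)
  simpa only [ContinuousMultilinearMap.norm_mkPiRing] using
    FormalMultilinearSeries.summable_norm_mul_pow _ (hrR.trans_le hball.r_le)

end NormedAlgebra

theorem catalan_le_four_pow (n : ℕ) : catalan n ≤ 4 ^ n := by
  rw [catalan_eq_centralBinom_div]
  exact (Nat.div_le_self _ _).trans n.centralBinom_le_four_pow

theorem tsum_catalan_nsmul_pow_eq {R : Type*} [NormedRing R] [CompleteSpace R] {s : R}
    (hs : Summable fun n => ‖catalan n • s ^ n‖) :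
    ∑' n, catalan n • s ^ n = 1 + s * (∑' n, catalan n • s ^ n) ^ 2 := by
  have hcauchy (n : ℕ) : ∑ kl ∈ antidiagonal n,
      (catalan kl.1 • s ^ kl.1) * (catalan kl.2 • s ^ kl.2) = catalan (n + 1) • s ^ n := by
    rw [catalan_succ', Finset.sum_smul]
    refine Finset.sum_congr rfl fun kl hkl => ?_
    rw [smul_mul_smul_comm, ← pow_add, mem_antidiagonal.1 hkl]
  have hsq := summable_norm_sum_mul_antidiagonal_of_summable_norm hs hs
  simp only [hcauchy] at hsq
  rw [sq, tsum_mul_tsum_eq_tsum_sum_antidiagonal_of_summable_norm hs hs,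
    hs.of_norm.tsum_eq_zero_add, catalan_zero, pow_zero, one_smul]
  simp only [hcauchy, pow_succ', ← mul_smul_comm]
  rw [hsq.of_norm.tsum_mul_left]

section NormedCommRing

variable {A : Type*} [NormedCommRing A] [NormedAlgebra ℂ A] [CompleteSpace A]

theorem isUnit_of_forall_character_ne_zero {a : A} (ha : ∀ φ : characterSpace ℂ A, φ a ≠ 0) :
    IsUnit a := by
  by_contra hunit
  obtain ⟨φ, hφ⟩ := CharacterSpace.exists_apply_eq_zero hunit
  exact ha φ hφ

theorem spectrum_subset_zero_of_forall_character_eq_zero {a : A}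
    (ha : ∀ φ : characterSpace ℂ A, φ a = 0) : spectrum ℂ a ⊆ {0} := by
  intro z hz
  obtain ⟨φ, rfl⟩ := CharacterSpace.mem_spectrum_iff_exists.1 hz
  exact ha φ

theorem exists_sub_sq_eq_of_forall_character_eq_zero {s : A}
    (hs : ∀ φ : characterSpace ℂ A, φ s = 0) : ∃ c : A, s * c - (s * c) ^ 2 = s := by
  have hradius : spectralRadius ℂ s = 0 := by
    rw [spectralRadius, ← bot_eq_zero, eq_bot_iff, iSup₂_le_iff]
    intro z hz
    simp [Set.mem_singleton_iff.1 (spectrum_subset_zero_of_forall_character_eq_zero hs hz)]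
  have hsummable : Summable fun n => ‖catalan n • s ^ n‖ := by
    refine (summable_norm_pow_mul_pow_of_lt_inv_spectralRadius (a := s) (r := 4)
      (by simp [hradius])).of_nonneg_of_le (fun n => norm_nonneg _) fun n => ?_
    calc ‖catalan n • s ^ n‖ ≤ catalan n * ‖s ^ n‖ := norm_nsmul_le
      _ ≤ 4 ^ n * ‖s ^ n‖ := by gcongr; exact_mod_cast catalan_le_four_pow n
      _ = ‖s ^ n‖ * ((4 : ℝ≥0) : ℝ) ^ n := by rw [mul_comm]; simp
  exact ⟨∑' n, catalan n • s ^ n, by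
    linear_combination s * tsum_catalan_nsmul_pow_eq hsummable⟩

theorem exists_isIdempotentElem_forall_character_eq {e : A}
    (he : ∀ φ : characterSpace ℂ A, IsIdempotentElem (φ e)) :
    ∃ f : A, IsIdempotentElem f ∧ ∀ φ : characterSpace ℂ A, φ f = φ e := by
  have hdefect (φ : characterSpace ℂ A) : φ (e ^ 2 - e) = 0 := by
    rw [map_sub, map_pow, sq, (he φ).eq, sub_self]
  obtain ⟨u, hu⟩ : IsUnit (1 + 4 * (e ^ 2 - e)) :=
    isUnit_of_forall_character_ne_zero fun φ => by simp [hdefect]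
  set s := (e ^ 2 - e) * ↑u⁻¹ with hs_def
  have hs (φ : characterSpace ℂ A) : φ s = 0 := by rw [map_mul, hdefect, zero_mul]
  obtain ⟨c, hc⟩ := exists_sub_sq_eq_of_forall_character_eq_zero hs
  have hus : (1 + 4 * (e ^ 2 - e)) * s = e ^ 2 - e := by
    rw [hs_def, ← hu, mul_left_comm, Units.mul_inv, mul_one]
  -- For `f = e + (1 - 2 * e) * y`, the defect `f ^ 2 - f` equals
  -- `(e ^ 2 - e) - (1 + 4 * (e ^ 2 - e)) * (y - y ^ 2)`.
  refine ⟨e + (1 - 2 * e) * (s * c), ?_, fun φ => by simp [hs]⟩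
  rw [IsIdempotentElem]
  linear_combination -(1 + 4 * (e ^ 2 - e)) * hc - hus

theorem exists_isIdempotentElem_of_finite_spectrum {b : A} (hb : (spectrum ℂ b).Finite)
    (S : Set ℂ) [DecidablePred (· ∈ S)] :
    ∃ f : A, IsIdempotentElem f ∧
      ∀ φ : characterSpace ℂ A, φ f = if φ b ∈ S then 1 else 0 := by
  let q : ℂ[X] := Lagrange.interpolate hb.toFinset id fun z => if z ∈ S then 1 else 0
  have hq (φ : characterSpace ℂ A) : φ (aeval b q) = if φ b ∈ S then 1 else 0 := by
    have hmem : φ b ∈ hb.toFinset := hb.mem_toFinset.2 (AlgHom.apply_mem_spectrum φ b)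
    rw [← aeval_algHom_apply, coe_aeval_eq_eval]
    exact Lagrange.eval_interpolate_at_node _ Function.injective_id.injOn hmem
  obtain ⟨f, hf, hφf⟩ := exists_isIdempotentElem_forall_character_eq (e := aeval b q) fun φ => by
    rw [hq, IsIdempotentElem]; split_ifs <;> simp
  exact ⟨f, hf, fun φ => (hφf φ).trans (hq φ)⟩

theorem isGDrazinInvertible_of_finite_spectrum_of_comm [Nontrivial A] {b : A}
    (hb : (spectrum ℂ b).Finite) : IsGDrazinInvertible b := by
  classical
  obtain ⟨f, hf, hφf⟩ := exists_isIdempotentElem_of_finite_spectrum hb {0}ᶜ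
  obtain ⟨u, hu⟩ : IsUnit (b + (1 - f)) := isUnit_of_forall_character_ne_zero fun φ => by
    by_cases hφ : φ b = 0 <;> simp [hφf, hφ]
  have hfu : f * ↑u = b * f := by rw [hu]; linear_combination -hf.eq
  have hbx : b * (f * ↑u⁻¹) = f := by rw [← mul_assoc, ← hfu, Units.mul_inv_cancel_right]
  refine ⟨f * ↑u⁻¹, mul_comm _ _, ?_, ?_⟩
  · rw [mul_assoc, hbx, mul_right_comm, hf.eq]
  · rw [sq, mul_assoc, hbx]
    refine (spectrum.nonempty _).subset_singleton_iff.1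
      (spectrum_subset_zero_of_forall_character_eq_zero fun φ => ?_)
    by_cases hφ : φ b = 0 <;> simp [hφf, hφ]

end NormedCommRing

section Banach

variable {A : Type*} [NormedRing A] [NormedAlgebra ℂ A] [CompleteSpace A]

theorem spectrum_elemental_eq_of_countable {b : A} (hb : (spectrum ℂ b).Countable) :
    spectrum ℂ (⟨b, Algebra.elemental.self_mem ℂ b⟩ : Algebra.elemental ℂ b) = spectrum ℂ b :=
  Subalgebra.spectrum_eq_of_isPreconnected_compl _ _
    (hb.isPathConnected_compl_of_one_lt_rank (by simp)).isConnected.isPreconnected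

theorem isGDrazinInvertible_of_finite_spectrum [Nontrivial A] {b : A}
    (hb : (spectrum ℂ b).Finite) : IsGDrazinInvertible b := by
  let B := Algebra.elemental ℂ b
  let b' : B := ⟨b, Algebra.elemental.self_mem ℂ b⟩
  let : NormedCommRing B := { (inferInstance : NormedRing B) with mul_comm := mul_comm }
  have hb' : (spectrum ℂ b').Finite := by
    rwa [spectrum_elemental_eq_of_countable hb.countable]
  exact (isGDrazinInvertible_of_finite_spectrum_of_comm hb').map B.val

/-- In the zero algebra every spectrum is empty, so no element is quasinilpotent there; the
nonemptiness in the first condition rules this algebra out. -/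
theorem mainTheorem5_general (a : A) :
    List.TFAE
      [∃ x : A, IsCommOuterInverse a x ∧
          (spectrum ℂ (a - a ^ 2 * x)).Finite ∧ (spectrum ℂ (a - a ^ 2 * x)).Nonempty,
       ∃ x : A, IsAGDrazinInverse a x ∧ (spectrum ℂ (a - a ^ 2 * x)).Finite,
       IsEGDrazinInvertible a,
       IsGDrazinInvertible a] := by
  tfae_have 1 → 3 := by
    rintro ⟨x, hx, hfin, hne⟩
    have : Nontrivial A := not_subsingleton_iff_nontrivial.1 fun _ =>
      hne.ne_empty (spectrum.of_subsingleton _)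
    exact ⟨x, hx.comm, hx.outer, isGDrazinInvertible_of_finite_spectrum hfin⟩
  tfae_have 3 → 4 := fun ⟨_, hx⟩ => hx.isGDrazinInvertible
  tfae_have 4 → 2 := fun ⟨x, hx⟩ =>
    ⟨x, hx.isAGDrazinInverse, hx.qnil.symm ▸ Set.finite_singleton 0⟩
  tfae_have 2 → 1 := by
    rintro ⟨x, hx, hfin⟩
    have := hx.acc.nontrivial
    exact ⟨x, ⟨hx.comm, hx.outer⟩, hfin, spectrum.nonempty _⟩
  tfae_finish

end Banach

theorem mainTheorem5 {A : Type*} [NormedRing A] [NormedAlgebra ℂ A] [CompleteSpace A] (a : A) :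
    List.TFAE
      [∃ x : A, IsAGDrazinInverse a x ∧ (spectrum ℂ (a - a ^ 2 * x)).Finite,
       IsEGDrazinInvertible a,
       IsGDrazinInvertible a] :=
  (List.tfae_cons_cons.1 (mainTheorem5_general a)).2
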